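/- Let $\mathcal X$ be a real Banach space with a predual Banach space $\mathcal X_*$ (so $\mathcal X=(\mathcal X_*)^*$), ordered by a weak* closed convex cone $\mathcal X^+$ that is proper ($\mathcal X^+\cap(-\mathcal X^+)=\{0\}$); write $x\le y$ if $y-x\in\mathcal X^+$. Put $\mathcal X_*^+=\{\varphi\in\mathcal X_*:\langle\varphi,x\rangle\ge 0\text{ for all }x\in\mathcal X^+\}$ and assume that $\mathcal X_*^+$ is generating: $\mathcal X_*=\mathcal X_*^+-\mathcal X_*^+$. A $C_0^*$ semigroup $T(t)$ on $\mathcal X$ is the adjoint of a $C_0$ semigroup $T_*(t)$ on $\mathcal X_*$; its generator is the weak* limit of $\frac1t(T(t)x-x)$ as $t\to0^+$, defined on those $x$ for which the limit exists. It is positive if $T(t)\mathcal X^+\subseteq\mathcal X^+$ for all $t\ge 0$, and exponentially stable if $\|T(t)\|\le Me^{-\varepsilon t}$ for some $M,\varepsilon>0$ and all $t\ge 0$. Let $A$, with domain $D_A$, be the generator of a positive $C_0^*$ semigroup on $\mathcal X$, and let $\Phi:\mathcal X^+\to\mathcal X$ be order concave, i.e. $\Phi(\alpha x+(1-\alpha)y)\ge\alpha\Phi(x)+(1-\alpha)\Phi(y)$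 for $\alpha\in[0,1]$, $x,y\in\mathcal X^+$, and Gateaux differentiable, i.e. for every $x\in\mathcal X^+$ a bounded linear operator $\Phi'(x)$ on $\mathcal X$ is given with $\frac1t(\Phi(x+th)-\Phi(x))\to\Phi'(x)h$ in norm, as $t\to0$ through the $t\ne 0$ with $x+th\in\mathcal X^+$, for every $h\in\mathcal X$. Set $F(x)=Ax+\Phi(x)$ for $x\in D_A\cap\mathcal X^+$ and, for $x\in\mathcal X^+$, $F'(x)=A+\Phi'(x)$ (with domain $D_A$) and $L(x)=\Phi(x)-\Phi'(x)x$. An element $x\in\mathcal X^+$ is called stabilizing if $F'(x)$ generates an exponentially stable positive $C_0^*$ semigroup. The pair $(A,\Phi)$ is exponentially stabilizable if some $x\in\mathcal X^+$ is stabilizing. It is globally $L^1$ detectable if for every $x\in\mathcal X^+$ the operator $F'(x)$ generates a positive $C_0^*$ semigroup $T_{F'(x)}(t)$, with pre-adjoint $T_{F'(x),*}(t)$, and there is a set $\mathcal F\subseteq\mathcal X_*^+$, independent of $x$, such that for every $x\in\mathcal X^+$: (a) if $\int_0^\infty\|T_{F'(x),*}(t)\varphi\|\,dt<\infty$ for all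 $\varphi\in\mathcal F$, then the same holds for all $\varphi\in\mathcal X_*^+$; (b) $L(x)\in\mathcal X^+$, and for every $\varphi\in\mathcal F$, $\int_0^\infty\langle T_{F'(x),*}(t)\varphi,L(x)\rangle\,dt<\infty$ implies $\int_0^\infty\|T_{F'(x),*}(t)\varphi\|\,dt<\infty$. Assume that $(A,\Phi)$ is exponentially stabilizable and globally $L^1$ detectable, that $\Phi(0)\ge 0$, and that $x\mapsto\Phi(x)$ on $\mathcal X^+$ and $(x,y)\mapsto\Phi'(x)y$ on $\mathcal X^+\times\mathcal X^+$ are continuous on order bounded monotone sequences: along every order bounded monotone (increasing or decreasing) sequence in the domain (for pairs, in the product order) with weak* limit in the domain, the values converge weak* to the value at the limit. Then the equation $F(x)=0$ has exactly one solution $x_\infty\in D_A\cap\mathcal X^+$, and $x_\infty$ is stabilizing. Moreover, for every stabilizing $x_0\in\mathcal X^+$, Newton's iteration $F(x_n)+F'(x_n)(x_{n+1}-x_n)=0$, read as $F'(x_n)x_{n+1}=-L(x_n)$ (which is equivalent when $x_n\in D_A$, and also makes sense if $x_0\notin D_A$), determines a unique sequence: at each step there is exactly one solution $x_{n+1}\in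 D_A$. One has $x_n\in D_A\cap\mathcal X^+$ and $x_n\ge x_{n+1}$ for all $n\ge1$, and $x_n\to x_\infty$ in the weak* topology. -/

import Mathlib

open Set Filter Topology MeasureTheory
open scoped NNReal

namespace ConcaveNewton

noncomputable section

/-- A `C₀` (strongly continuous one-parameter) semigroup of bounded operators on `E`. -/
structure C0Semigroup (E : Type*) [NormedAddCommGroup E] [NormedSpace ℝ E] where
  /-- the operator at time `t ≥ 0` -/
  op : ℝ≥0 → E →L[ℝ] E
  op_zero : op 0 = ContinuousLinearMap.id ℝ E
  op_add : ∀ s t, op (s + t) = (op s).comp (op t)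
  continuous_orbit : ∀ φ : E, Continuous fun t => op t φ

variable {E : Type*} [NormedAddCommGroup E] [NormedSpace ℝ E]

/-- Weak* convergence in the dual space. -/
def TendstoWeakStar {ι : Type*} (u : ι → StrongDual ℝ E) (l : Filter ι)
    (x : StrongDual ℝ E) : Prop :=
  Tendsto (fun i => StrongDual.toWeakDual (u i)) l (𝓝 (StrongDual.toWeakDual x))

/-- `P` is weak* closed and proper: `P ∩ -P = {0}`. -/
structure IsClosedProper (P : PointedCone ℝ (StrongDual ℝ E)) : Prop where
  isClosed_weakStar : IsClosed (StrongDual.toWeakDual '' (P : Set (StrongDual ℝ E)))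
  proper : ∀ x ∈ P, -x ∈ P → x = 0

/-- The cone `{φ | ⟨φ, x⟩ ≥ 0 for all x ∈ P}` in the predual. -/
def predualCone (P : PointedCone ℝ (StrongDual ℝ E)) : Set E :=
  {φ | ∀ x ∈ P, 0 ≤ x φ}

/-- A subset `K` is generating: every element is a difference of two elements of `K`. -/
def IsGenerating (K : Set E) : Prop :=
  ∀ φ : E, ∃ a ∈ K, ∃ b ∈ K, φ = a - b

/-- The order defined by the cone: `x ≤ y` iff `y - x ∈ P`. -/
def ConeLE (P : PointedCone ℝ (StrongDual ℝ E)) (x y : StrongDual ℝ E) : Prop :=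
  y - x ∈ P

/-! ### `C₀*` semigroups -/

namespace C0Semigroup

/-- The `C₀*` semigroup on the dual space adjoint to the `C₀` semigroup `S`:
`⟨φ, T(t) x⟩ = ⟨S(t) φ, x⟩`. -/
def adj (S : C0Semigroup E) (t : ℝ≥0) : StrongDual ℝ E →L[ℝ] StrongDual ℝ E :=
  (S.op t).precomp ℝ

theorem adj_apply (S : C0Semigroup E) (t : ℝ≥0) (x : StrongDual ℝ E) (φ : E) :
    S.adj t x φ = x (S.op t φ) := rfl

/-- `A` is the generator of the `C₀*` semigroup adjoint to `S`: `A x = y` holds (with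
`x ∈ D(A)`) exactly when `(T(t) x - x) / t` converges weak* to `y` as `t → 0+`. -/
def IsGenerator (S : C0Semigroup E) (A : StrongDual ℝ E →ₗ.[ℝ] StrongDual ℝ E) : Prop :=
  ∀ x y : StrongDual ℝ E, (∃ hx : x ∈ A.domain, A ⟨x, hx⟩ = y) ↔
    TendstoWeakStar (fun t : ℝ≥0 => (t : ℝ)⁻¹ • (S.adj t x - x)) (𝓝[>] 0) y

/-- The `C₀*` semigroup adjoint to `S` preserves the cone `P`. -/
def IsPositive (S : C0Semigroup E) (P : PointedCone ℝ (StrongDual ℝ E)) : Prop :=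
  ∀ t, ∀ x ∈ P, S.adj t x ∈ P

/-- The `C₀*` semigroup adjoint to `S` is exponentially stable. -/
def IsExpStable (S : C0Semigroup E) : Prop :=
  ∃ M ε : ℝ, 0 < ε ∧ ∀ t : ℝ≥0, ‖S.adj t‖ ≤ M * Real.exp (-ε * t)

/-- `∫₀^∞ ‖S(t) φ‖ dt < ∞`. -/
def FiniteNormIntegral (S : C0Semigroup E) (φ : E) : Prop :=
  IntegrableOn (fun t : ℝ => ‖S.op t.toNNReal φ‖) (Ioi 0)

/-- `∫₀^∞ ⟨S(t) φ, z⟩ dt < ∞` (the integrand is nonnegative wherever this is used). -/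
def FinitePairingIntegral (S : C0Semigroup E) (z : StrongDual ℝ E) (φ : E) : Prop :=
  IntegrableOn (fun t : ℝ => z (S.op t.toNNReal φ)) (Ioi 0)

/-- `z ∈ P` is an `L¹` detector on `F` for the `C₀*` semigroup adjoint to `S`. -/
def IsL1Detector (S : C0Semigroup E) (P : PointedCone ℝ (StrongDual ℝ E)) (F : Set E)
    (z : StrongDual ℝ E) : Prop :=
  z ∈ P ∧ ∀ φ ∈ F, S.FinitePairingIntegral z φ → S.FiniteNormIntegral φ

end C0Semigroup

/-- `F` is a stability subset of the predual cone for the class `𝒞` of semigroups. -/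
def IsStabilitySubset (P : PointedCone ℝ (StrongDual ℝ E)) (𝒞 : Set (C0Semigroup E))
    (F : Set E) : Prop :=
  F ⊆ predualCone P ∧ ∀ S ∈ 𝒞, (∀ φ ∈ F, S.FiniteNormIntegral φ) →
    ∀ φ ∈ predualCone P, S.FiniteNormIntegral φ

/-! ### The nonlinear part -/

/-- `Φ` is order concave on the cone `P`. -/
def IsOrderConcave (P : PointedCone ℝ (StrongDual ℝ E))
    (Φ : StrongDual ℝ E → StrongDual ℝ E) : Prop :=
  ∀ α ∈ Icc (0 : ℝ) 1, ∀ x ∈ P, ∀ y ∈ P,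
    ConeLE P (α • Φ x + (1 - α) • Φ y) (Φ (α • x + (1 - α) • y))

/-- The bounded operator `Φ' x` is a Gateaux derivative at `x` of `Φ` as a map on `P`, for every
`x ∈ P`: for every `h`, `(Φ (x + t h) - Φ x) / t → Φ' x h` in norm as `t → 0` with
`t ≠ 0` and `x + t h ∈ P`. -/
def IsGateauxDeriv (P : PointedCone ℝ (StrongDual ℝ E))
    (Φ : StrongDual ℝ E → StrongDual ℝ E)
    (Φ' : StrongDual ℝ E → StrongDual ℝ E →L[ℝ] StrongDual ℝ E) : Prop :=
  ∀ x ∈ P, ∀ h : StrongDual ℝ E,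
    HasLineDerivWithinAt ℝ Φ (Φ' x h) (P : Set (StrongDual ℝ E)) x h

/-- The sequence is monotone increasing in the order of `P`. -/
def IsIncreasing (P : PointedCone ℝ (StrongDual ℝ E)) (u : ℕ → StrongDual ℝ E) : Prop :=
  ∀ m n, m ≤ n → ConeLE P (u m) (u n)

/-- The sequence is monotone decreasing in the order of `P`. -/
def IsDecreasing (P : PointedCone ℝ (StrongDual ℝ E)) (u : ℕ → StrongDual ℝ E) : Prop :=
  ∀ m n, m ≤ n → ConeLE P (u n) (u m)

/-- The sequence is order bounded in the order of `P`. -/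
def IsOrderBounded (P : PointedCone ℝ (StrongDual ℝ E)) (u : ℕ → StrongDual ℝ E) : Prop :=
  ∃ a b, ∀ n, ConeLE P a (u n) ∧ ConeLE P (u n) b

/-- `Θ : P → 𝒳` is (weak*) continuous on order bounded monotone sequences. -/
def ContinuousOnMonotoneSeq (P : PointedCone ℝ (StrongDual ℝ E))
    (Θ : StrongDual ℝ E → StrongDual ℝ E) : Prop :=
  ∀ (u : ℕ → StrongDual ℝ E) (x : StrongDual ℝ E), (∀ n, u n ∈ P) → x ∈ P →
    IsOrderBounded P u → IsIncreasing P u ∨ IsDecreasing P u →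
    TendstoWeakStar u atTop x → TendstoWeakStar (fun n => Θ (u n)) atTop (Θ x)

/-- `Θ : P × P → 𝒳` is (weak*) continuous on order bounded monotone sequences, where
`P × P` carries the product order and the product of the weak* topologies. -/
def ContinuousOnMonotoneSeq₂ (P : PointedCone ℝ (StrongDual ℝ E))
    (Θ : StrongDual ℝ E → StrongDual ℝ E → StrongDual ℝ E) : Prop :=
  ∀ (u v : ℕ → StrongDual ℝ E) (x y : StrongDual ℝ E),
    (∀ n, u n ∈ P) → (∀ n, v n ∈ P) → x ∈ P → y ∈ P →
    IsOrderBounded P u → IsOrderBounded P v →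
    (IsIncreasing P u ∧ IsIncreasing P v) ∨ (IsDecreasing P u ∧ IsDecreasing P v) →
    TendstoWeakStar u atTop x → TendstoWeakStar v atTop y →
    TendstoWeakStar (fun n => Θ (u n) (v n)) atTop (Θ x y)

/-! ### The equation `A x + Φ x = 0` -/

/-- `F'(x) = A + Φ'(x)`, with domain `D(A)`. -/
def linearization (A : StrongDual ℝ E →ₗ.[ℝ] StrongDual ℝ E)
    (Φ' : StrongDual ℝ E → StrongDual ℝ E →L[ℝ] StrongDual ℝ E) (x : StrongDual ℝ E) :
    StrongDual ℝ E →ₗ.[ℝ] StrongDual ℝ E :=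
  (Φ' x : StrongDual ℝ E →ₗ[ℝ] StrongDual ℝ E) +ᵥ A

/-- `x ∈ P` stabilizes `(A, Φ)`: `F'(x)` generates an exponentially stable positive `C₀*`
semigroup. -/
def Stabilizes (P : PointedCone ℝ (StrongDual ℝ E))
    (A : StrongDual ℝ E →ₗ.[ℝ] StrongDual ℝ E)
    (Φ' : StrongDual ℝ E → StrongDual ℝ E →L[ℝ] StrongDual ℝ E)
    (x : StrongDual ℝ E) : Prop :=
  x ∈ P ∧ ∃ S : C0Semigroup E,
    S.IsPositive P ∧ S.IsGenerator (linearization A Φ' x) ∧ S.IsExpStable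

/-- `(A, Φ)` is globally `L¹` detectable: there is one stability subset `F` (for the class of all
the semigroups involved) such that, for every `x ∈ P`, `F'(x)` generates a positive `C₀*`
semigroup for which `L(x) = Φ(x) - Φ'(x) x` is an `L¹` detector on `F`. -/
def GloballyL1Detectable (P : PointedCone ℝ (StrongDual ℝ E))
    (A : StrongDual ℝ E →ₗ.[ℝ] StrongDual ℝ E)
    (Φ : StrongDual ℝ E → StrongDual ℝ E)
    (Φ' : StrongDual ℝ E → StrongDual ℝ E →L[ℝ] StrongDual ℝ E) : Prop :=
  ∃ F : Set E,
    IsStabilitySubset P {S | ∃ x ∈ P, S.IsGenerator (linearization A Φ' x)} F ∧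
    ∀ x ∈ P, ∃ S : C0Semigroup E, S.IsPositive P ∧ S.IsGenerator (linearization A Φ' x) ∧
      S.IsL1Detector P F (Φ x - Φ' x x)

/-- `x ∈ D(A)` and `A x + Φ x = 0`. -/
def IsSolution (A : StrongDual ℝ E →ₗ.[ℝ] StrongDual ℝ E)
    (Φ : StrongDual ℝ E → StrongDual ℝ E) (x : StrongDual ℝ E) : Prop :=
  ∃ hx : x ∈ A.domain, A ⟨x, hx⟩ + Φ x = 0

/-- `v` results from `u` by a Newton step: `v ∈ D(A)` and
`F'(u) v = -(Φ u - Φ'(u) u)`. For `u ∈ D(A)` this is `F(u) + F'(u) (v - u) = 0`, see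
`isNewtonStep_iff`; in this form it also makes sense for a starting point outside `D(A)`. -/
def IsNewtonStep (A : StrongDual ℝ E →ₗ.[ℝ] StrongDual ℝ E)
    (Φ : StrongDual ℝ E → StrongDual ℝ E)
    (Φ' : StrongDual ℝ E → StrongDual ℝ E →L[ℝ] StrongDual ℝ E)
    (u v : StrongDual ℝ E) : Prop :=
  ∃ hv : v ∈ (linearization A Φ' u).domain,
    linearization A Φ' u ⟨v, hv⟩ = -(Φ u - Φ' u u)

theorem isNewtonStep_iff (A : StrongDual ℝ E →ₗ.[ℝ] StrongDual ℝ E)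
    (Φ : StrongDual ℝ E → StrongDual ℝ E)
    (Φ' : StrongDual ℝ E → StrongDual ℝ E →L[ℝ] StrongDual ℝ E)
    (u v : StrongDual ℝ E) (hu : u ∈ A.domain) :
    IsNewtonStep A Φ Φ' u v ↔
      ∃ hd : v - u ∈ (linearization A Φ' u).domain,
        (A ⟨u, hu⟩ + Φ u) + linearization A Φ' u ⟨v - u, hd⟩ = 0 := by
  have key : ∀ (hv : v ∈ A.domain) (hd : v - u ∈ A.domain),
      A ⟨v - u, hd⟩ = A ⟨v, hv⟩ - A ⟨u, hu⟩ := by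
    intro hv hd
    rw [← LinearPMap.map_sub]
    rfl
  constructor
  · rintro ⟨hv, h⟩
    refine ⟨A.domain.sub_mem hv hu, ?_⟩
    simp only [linearization, LinearPMap.vadd_apply] at h ⊢
    rw [key hv (A.domain.sub_mem hv hu)]
    simp only [ContinuousLinearMap.coe_coe, map_sub] at h ⊢
    rw [← sub_eq_zero] at h
    rw [← h]
    abel
  · rintro ⟨hd, h⟩
    have hv : v ∈ A.domain := by
      have := A.domain.add_mem hd hu
      simpa using this
    refine ⟨hv, ?_⟩
    simp only [linearization, LinearPMap.vadd_apply] at h ⊢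
    rw [key hv hd] at h
    simp only [ContinuousLinearMap.coe_coe, map_sub] at h ⊢
    rw [← sub_eq_zero, ← h]
    abel

end

end ConcaveNewton

open ConcaveNewton

/-! Call `y ∈ P ∩ D(A)` a supersolution if `A y + Φ y ≤ 0`. Since `F'(y) y + L(y) = A y + Φ y`,
integrating along `S.op t φ` bounds the pairing integral of `L(y)` by `y φ`. Detectability turns
this into integrable orbits, and Datko–Pazy into exponential stability. So every supersolution, in
particular every solution, is stabilizing (`IsSupersolution.stabilizes`).

At a stabilizing `x` the operator `-F'(x)⁻¹ = ∫₀^∞ T(t) dt` is positive. Together with the tangent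
inequality for concave `Φ`, this makes each Newton step from `x` a supersolution
(`IsNewtonStep.isSupersolution`), so the iteration never stops; a step from a supersolution goes
down (`IsNewtonStep.coneLE`). The iterates thus decrease in `P` and converge weak*, and the weak*
closed graph of `A` makes the limit a solution. Two solutions are both stabilizing, so by
`IsSolution.coneLE` each lies below the other, and they coincide because `P` is proper. -/

namespace ConcaveNewton

/-! ### Weak* convergence and the cone -/

section WeakStar

variable {E : Type*} [NormedAddCommGroup E] [NormedSpace ℝ E]

theorem tendstoWeakStar_iff {ι : Type*} {u : ι → StrongDual ℝ E} {l : Filter ι}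
    {x : StrongDual ℝ E} :
    TendstoWeakStar u l x ↔ ∀ φ, Tendsto (fun i => u i φ) l (𝓝 (x φ)) :=
  WeakBilin.tendsto_iff_forall_eval_tendsto (topDualPairing ℝ E)
    ContinuousLinearMap.coe_injective

theorem TendstoWeakStar.neg {ι : Type*} {u : ι → StrongDual ℝ E} {l : Filter ι}
    {x : StrongDual ℝ E} (hx : TendstoWeakStar u l x) :
    TendstoWeakStar (fun i => -u i) l (-x) :=
  tendstoWeakStar_iff.2 fun φ => (tendstoWeakStar_iff.1 hx φ).neg

theorem TendstoWeakStar.sub {ι : Type*} {u v : ι → StrongDual ℝ E} {l : Filter ι}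
    {x y : StrongDual ℝ E} (hx : TendstoWeakStar u l x) (hy : TendstoWeakStar v l y) :
    TendstoWeakStar (fun i => u i - v i) l (x - y) :=
  tendstoWeakStar_iff.2 fun φ => (tendstoWeakStar_iff.1 hx φ).sub (tendstoWeakStar_iff.1 hy φ)

/-- The bipolar theorem for weak* closed cones. -/
theorem IsClosedProper.mem_of_forall_nonneg {P : PointedCone ℝ (StrongDual ℝ E)}
    (hP : IsClosedProper P) {x : StrongDual ℝ E} (hx : ∀ φ ∈ predualCone P, 0 ≤ x φ) : x ∈ P := by
  by_contra hxP
  set C : Set (WeakDual ℝ E) := StrongDual.toWeakDual '' (P : Set (StrongDual ℝ E)) with hC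
  have hconv : Convex ℝ C := by
    have : Convex ℝ (P : Set (StrongDual ℝ E)) := P.convex
    exact this.linear_image (StrongDual.toWeakDual (𝕜 := ℝ) (E := E)).toLinearMap
  have hxC : StrongDual.toWeakDual x ∉ C := by
    rintro ⟨y, hy, hyx⟩
    exact hxP ((StrongDual.toWeakDual_inj _ _).1 hyx ▸ hy)
  have : LocallyConvexSpace ℝ (WeakDual ℝ E) :=
    inferInstanceAs (LocallyConvexSpace ℝ (WeakBilin (topDualPairing ℝ E)))
  obtain ⟨f, u, hfx, hfC⟩ := geometric_hahn_banach_point_closed hconv hP.isClosed_weakStar hxC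
  -- A weak* continuous functional is evaluation at a point of the predual.
  obtain ⟨φ, hφ⟩ := LinearMap.dualEmbedding_surjective (topDualPairing ℝ E) f
  have hf : ∀ y : StrongDual ℝ E, f (StrongDual.toWeakDual y) = y φ := fun y => by
    rw [← hφ]; rfl
  have hu : u < 0 := by
    have := hfC _ ⟨0, P.zero_mem, rfl⟩
    rwa [hf] at this
  have hmem : φ ∈ predualCone P := by
    intro y hy
    by_contra! hneg
    -- If `y φ < 0`, this nonnegative multiple of `y` is sent exactly to `u`, against the strict
    -- separation.
    have hc : 0 ≤ u / y φ := div_nonneg_of_nonpos hu.le hneg.le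
    have := hfC _ ⟨(u / y φ) • y, P.smul_mem hc hy, rfl⟩
    rw [hf] at this
    have h2 : ((u / y φ) • y) φ = u := div_mul_cancel₀ u hneg.ne
    linarith
  have := hx φ hmem
  rw [hf] at hfx
  linarith

/-- A weak* convergent sequence in the dual of a Banach space is bounded. -/
theorem TendstoWeakStar.exists_norm_le [CompleteSpace E] {u : ℕ → StrongDual ℝ E}
    {x : StrongDual ℝ E} (hu : TendstoWeakStar u atTop x) : ∃ C, ∀ n, ‖u n‖ ≤ C := by
  refine banach_steinhaus fun φ => ?_
  obtain ⟨C, hC⟩ := ((tendstoWeakStar_iff.1 hu φ).norm).bddAbove_range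
  exact ⟨C, fun n => hC ⟨n, rfl⟩⟩

/-- A decreasing sequence in a weak* closed cone whose predual cone is generating converges
weak* to an element of the cone. -/
theorem IsDecreasing.exists_tendstoWeakStar [CompleteSpace E]
    {P : PointedCone ℝ (StrongDual ℝ E)} (hP : IsClosedProper P)
    (hgen : IsGenerating (predualCone P)) {u : ℕ → StrongDual ℝ E} (hu : IsDecreasing P u)
    (huP : ∀ n, u n ∈ P) : ∃ x ∈ P, TendstoWeakStar u atTop x := by
  have hcone : ∀ φ ∈ predualCone P, ∃ r, Tendsto (fun n => u n φ) atTop (𝓝 r) := by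
    intro φ hφ
    refine ⟨_, tendsto_atTop_ciInf (fun m n hmn => ?_) ⟨0, ?_⟩⟩
    · have := hφ _ (hu m n hmn)
      simpa using this
    · rintro _ ⟨n, rfl⟩
      exact hφ _ (huP n)
  have hall : ∀ φ, ∃ r, Tendsto (fun n => u n φ) atTop (𝓝 r) := by
    intro φ
    obtain ⟨a, ha, b, hb, rfl⟩ := hgen φ
    obtain ⟨r, hr⟩ := hcone a ha
    obtain ⟨s, hs⟩ := hcone b hb
    exact ⟨r - s, by simpa using hr.sub hs⟩
  choose g hg using hall
  -- By Banach–Steinhaus the pointwise limit is a bounded functional.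
  have hlim : TendstoWeakStar u atTop
      (continuousLinearMapOfTendsto u (tendsto_pi_nhds.2 hg)) :=
    tendstoWeakStar_iff.2 hg
  refine ⟨_, hP.mem_of_forall_nonneg fun φ hφ => ?_, hlim⟩
  exact ge_of_tendsto' (hg φ) fun n => hφ _ (huP n)

end WeakStar

/-! ### Generators as integrated equations, and their inverses -/

namespace C0Semigroup

variable {E : Type*} [NormedAddCommGroup E] [NormedSpace ℝ E] (S : C0Semigroup E)

theorem op_add_apply (s t : ℝ≥0) (φ : E) : S.op (s + t) φ = S.op s (S.op t φ) := by
  rw [S.op_add]; rfl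

theorem continuous_op_toNNReal (φ : E) : Continuous fun t : ℝ => S.op t.toNNReal φ :=
  (S.continuous_orbit φ).comp continuous_real_toNNReal

theorem op_toNNReal_add {s t : ℝ} (hs : 0 ≤ s) (ht : 0 ≤ t) (φ : E) :
    S.op (s + t).toNNReal φ = S.op s.toNNReal (S.op t.toNNReal φ) := by
  rw [Real.toNNReal_add hs ht, op_add_apply]

variable {S} in
theorem IsPositive.op_mem {P : PointedCone ℝ (StrongDual ℝ E)} (hS : S.IsPositive P) (t : ℝ≥0)
    {φ : E} (hφ : φ ∈ predualCone P) : S.op t φ ∈ predualCone P :=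
  fun x hx => hφ _ (hS t x hx)

theorem _root_.ConcaveNewton.tendsto_toNNReal_nhdsGT_zero :
    Tendsto Real.toNNReal (𝓝[>] 0) (𝓝[>] 0) := by
  refine tendsto_nhdsWithin_iff.2 ⟨?_, ?_⟩
  · have := (continuous_real_toNNReal.tendsto 0).mono_left (nhdsWithin_le_nhds (s := Ioi 0))
    simpa using this
  · filter_upwards [self_mem_nhdsWithin] with t ht
    exact Real.toNNReal_pos.2 ht

theorem _root_.ConcaveNewton.tendsto_coe_nhdsGT_zero :
    Tendsto ((↑) : ℝ≥0 → ℝ) (𝓝[>] 0) (𝓝[>] 0) := by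
  refine tendsto_nhdsWithin_iff.2 ⟨?_, ?_⟩
  · exact (NNReal.continuous_coe.tendsto 0).mono_left nhdsWithin_le_nhds
  · filter_upwards [self_mem_nhdsWithin] with t ht
    exact_mod_cast ht

variable {S} {A : StrongDual ℝ E →ₗ.[ℝ] StrongDual ℝ E}

/-- Orbits in the domain of the generator are integrals of their derivatives. -/
theorem IsGenerator.integral_eq (hA : S.IsGenerator A) {x : StrongDual ℝ E} (hx : x ∈ A.domain)
    (φ : E) {t : ℝ} (ht : 0 ≤ t) :
    ∫ s in 0..t, A ⟨x, hx⟩ (S.op s.toNNReal φ) = x (S.op t.toNNReal φ) - x φ := by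
  have hlim := tendstoWeakStar_iff.1 ((hA x (A ⟨x, hx⟩)).1 ⟨hx, rfl⟩)
  have h0 : x φ = x (S.op (0 : ℝ).toNNReal φ) := by simp [S.op_zero]
  rw [h0]
  -- The generator controls only right difference quotients: the increment of the orbit from `s` to
  -- `r` is `T(r - s) x - x` evaluated at `S.op s φ`. With continuity this suffices.
  refine intervalIntegral.integral_eq_sub_of_hasDeriv_right_of_le ht
    (f := fun s => x (S.op s.toNNReal φ))
    (x.continuous.comp (S.continuous_op_toNNReal φ)).continuousOn (fun s hs => ?_)
    (((A ⟨x, hx⟩).continuous.comp (S.continuous_op_toNNReal φ)).intervalIntegrable _ _)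
  rw [hasDerivWithinAt_iff_tendsto_slope' self_notMem_Ioi]
  have h1 := (hlim (S.op s.toNNReal φ)).comp tendsto_toNNReal_nhdsGT_zero
  have h2 : Tendsto (fun r : ℝ => r - s) (𝓝[>] s) (𝓝[>] 0) := by
    refine tendsto_nhdsWithin_iff.2 ⟨?_, ?_⟩
    · have : Continuous fun r : ℝ => r - s := by fun_prop
      simpa using (this.tendsto s).mono_left (nhdsWithin_le_nhds (s := Ioi s))
    · filter_upwards [self_mem_nhdsWithin] with r hr
      exact sub_pos.2 (mem_Ioi.1 hr)
  refine (h1.comp h2).congr' ?_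
  filter_upwards [self_mem_nhdsWithin] with r hr
  have hr' : 0 ≤ r - s := sub_nonneg.2 (le_of_lt hr)
  have h3 := S.op_toNNReal_add hr' hs.1.le φ
  rw [sub_add_cancel] at h3
  simp only [Function.comp_apply, slope_def_field, Real.coe_toNNReal _ hr',
    _root_.smul_apply, _root_.sub_apply, adj_apply, smul_eq_mul, h3]
  ring

theorem tendsto_average_op (S : C0Semigroup E) (y : StrongDual ℝ E) (φ : E) :
    Tendsto (fun t : ℝ≥0 => (t : ℝ)⁻¹ * ∫ s in 0..(t : ℝ), y (S.op s.toNNReal φ))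
      (𝓝[>] 0) (𝓝 (y φ)) := by
  have hc : Continuous fun s : ℝ => y (S.op s.toNNReal φ) :=
    y.continuous.comp (S.continuous_op_toNNReal φ)
  have hd : HasDerivAt (fun t : ℝ => ∫ s in 0..t, y (S.op s.toNNReal φ)) (y φ) 0 := by
    have := hc.integral_hasStrictDerivAt 0 0
    simpa [S.op_zero] using this.hasDerivAt
  have h1 := (hasDerivWithinAt_iff_tendsto_slope' self_notMem_Ioi).1
    (hd.hasDerivWithinAt (s := Ioi 0))
  refine (h1.comp tendsto_coe_nhdsGT_zero).congr fun t => ?_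
  simp [slope_def_field, div_eq_inv_mul]

/-- Dividing by `t` and averaging recovers the generator. Unlike the defining limit, the integrated
identity passes to weak* limits and can be checked directly for `∫₀^∞ T(t) y dt`. -/
theorem IsGenerator.of_integral_eq (hA : S.IsGenerator A) {x y : StrongDual ℝ E}
    (h : ∀ φ : E, ∀ t : ℝ, 0 ≤ t →
      ∫ s in 0..t, y (S.op s.toNNReal φ) = x (S.op t.toNNReal φ) - x φ) :
    ∃ hx : x ∈ A.domain, A ⟨x, hx⟩ = y := by
  refine (hA x y).2 (tendstoWeakStar_iff.2 fun φ => ?_)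
  refine (S.tendsto_average_op y φ).congr fun t => ?_
  rw [h φ t t.2]
  simp [adj_apply]

theorem exists_norm_op_le_on_Icc (S : C0Semigroup E) (φ : E) (t : ℝ) :
    ∃ C, ∀ s ∈ Icc 0 t, ‖S.op s.toNNReal φ‖ ≤ C :=
  isCompact_Icc.exists_bound_of_continuousOn (S.continuous_op_toNNReal φ).continuousOn

/-- The generator has a sequentially weak* closed graph. -/
theorem IsGenerator.of_tendstoWeakStar [CompleteSpace E] (hA : S.IsGenerator A)
    {u v : ℕ → StrongDual ℝ E} {x y : StrongDual ℝ E}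
    (huv : ∀ n, ∃ hu : u n ∈ A.domain, A ⟨u n, hu⟩ = v n)
    (hu : TendstoWeakStar u atTop x) (hv : TendstoWeakStar v atTop y) :
    ∃ hx : x ∈ A.domain, A ⟨x, hx⟩ = y := by
  refine hA.of_integral_eq fun φ t ht => ?_
  obtain ⟨C, hC⟩ := hv.exists_norm_le
  obtain ⟨D, hD⟩ := S.exists_norm_op_le_on_Icc φ t
  have hlim1 : Tendsto (fun n => ∫ s in 0..t, v n (S.op s.toNNReal φ)) atTop
      (𝓝 (∫ s in 0..t, y (S.op s.toNNReal φ))) := by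
    refine intervalIntegral.tendsto_integral_filter_of_dominated_convergence (fun _ => C * D)
      (Eventually.of_forall fun n => ?_) (Eventually.of_forall fun n => ?_)
      intervalIntegrable_const (Eventually.of_forall fun s _ => ?_)
    · exact ((v n).continuous.comp (S.continuous_op_toNNReal φ)).aestronglyMeasurable
    · refine Eventually.of_forall fun s hs => ?_
      rw [uIoc_of_le ht] at hs
      exact (v n).le_of_opNorm_le_of_le (hC n) (hD s (Ioc_subset_Icc_self hs))
    · exact tendstoWeakStar_iff.1 hv _
  have hlim2 := ((tendstoWeakStar_iff.1 hu (S.op t.toNNReal φ)).sub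
    (tendstoWeakStar_iff.1 hu φ))
  refine tendsto_nhds_unique hlim1 (hlim2.congr fun n => ?_)
  obtain ⟨hn, hvn⟩ := huv n
  rw [← hA.integral_eq hn φ ht, hvn]

/-! ### Exponentially stable semigroups -/

theorem IsExpStable.exists_bound (hS : S.IsExpStable) : ∃ M ε : ℝ, 0 < ε ∧
    ∀ (y : StrongDual ℝ E) (φ : E) (t : ℝ), 0 ≤ t →
      ‖y (S.op t.toNNReal φ)‖ ≤ M * ‖y‖ * ‖φ‖ * Real.exp (-ε * t) := by
  obtain ⟨M, ε, hε, h⟩ := hS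
  refine ⟨M, ε, hε, fun y φ t ht => ?_⟩
  have h1 := h t.toNNReal
  rw [Real.coe_toNNReal t ht] at h1
  calc ‖y (S.op t.toNNReal φ)‖ = ‖S.adj t.toNNReal y φ‖ := rfl
    _ ≤ ‖S.adj t.toNNReal y‖ * ‖φ‖ := ContinuousLinearMap.le_opNorm _ _
    _ ≤ (‖S.adj t.toNNReal‖ * ‖y‖) * ‖φ‖ := by
        gcongr; exact ContinuousLinearMap.le_opNorm _ _
    _ ≤ (M * Real.exp (-ε * t) * ‖y‖) * ‖φ‖ := by gcongr
    _ = _ := by ring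

theorem IsExpStable.integrableOn (hS : S.IsExpStable) (y : StrongDual ℝ E) (φ : E) :
    IntegrableOn (fun t : ℝ => y (S.op t.toNNReal φ)) (Ioi 0) := by
  obtain ⟨M, ε, hε, h⟩ := hS.exists_bound
  refine Integrable.mono' ((exp_neg_integrableOn_Ioi 0 hε).const_mul (M * ‖y‖ * ‖φ‖))
    (y.continuous.comp (S.continuous_op_toNNReal φ)).aestronglyMeasurable ?_
  filter_upwards [ae_restrict_mem measurableSet_Ioi] with t ht
  exact h y φ t (le_of_lt ht)

theorem IsExpStable.tendsto_zero (hS : S.IsExpStable) (y : StrongDual ℝ E) (φ : E) :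
    Tendsto (fun t : ℝ => y (S.op t.toNNReal φ)) atTop (𝓝 0) := by
  obtain ⟨M, ε, hε, h⟩ := hS.exists_bound
  have h1 : Tendsto (fun t : ℝ => M * ‖y‖ * ‖φ‖ * Real.exp (-ε * t)) atTop (𝓝 0) := by
    have : Tendsto (fun t : ℝ => -ε * t) atTop atBot :=
      tendsto_id.const_mul_atTop_of_neg (neg_lt_zero.2 hε)
    simpa using (Real.tendsto_exp_atBot.comp this).const_mul (M * ‖y‖ * ‖φ‖)
  refine squeeze_zero_norm' ?_ h1
  filter_upwards [eventually_ge_atTop 0] with t ht using h y φ t ht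

/-- The generator of an exponentially stable semigroup is onto: a preimage of `-y` is
`∫₀^∞ T(t) y dt`. -/
theorem IsExpStable.exists_apply_eq_neg (hS : S.IsExpStable) (hA : S.IsGenerator A)
    (y : StrongDual ℝ E) : ∃ x : StrongDual ℝ E, (∃ hx : x ∈ A.domain, A ⟨x, hx⟩ = -y) ∧
      ∀ φ, x φ = ∫ t in Ioi (0 : ℝ), y (S.op t.toNNReal φ) := by
  obtain ⟨M, ε, hε, h⟩ := hS.exists_bound
  have hint := hS.integrableOn y
  let x₀ : E →ₗ[ℝ] ℝ :=
    { toFun := fun φ => ∫ t in Ioi (0 : ℝ), y (S.op t.toNNReal φ)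
      map_add' := fun φ ψ => by
        simp only [map_add]
        exact integral_add (hint φ) (hint ψ)
      map_smul' := fun c φ => by
        simp only [map_smul, RingHom.id_apply]
        exact integral_smul c _ }
  let I := ∫ t in Ioi (0 : ℝ), Real.exp (-ε * t)
  have hb : ∀ φ, ‖x₀ φ‖ ≤ (M * ‖y‖ * I) * ‖φ‖ := by
    intro φ
    calc ‖x₀ φ‖ ≤ ∫ t in Ioi (0 : ℝ), M * ‖y‖ * ‖φ‖ * Real.exp (-ε * t) := by
          refine norm_integral_le_of_norm_le ((exp_neg_integrableOn_Ioi 0 hε).const_mul _) ?_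
          filter_upwards [ae_restrict_mem measurableSet_Ioi] with t ht
          exact h y φ t (le_of_lt ht)
      _ = (M * ‖y‖ * I) * ‖φ‖ := by rw [integral_const_mul]; ring
  refine ⟨x₀.mkContinuous _ hb, hA.of_integral_eq fun φ t ht => ?_, fun φ => rfl⟩
  have hx₀ : ∀ ψ, x₀.mkContinuous _ hb ψ = ∫ t in Ioi (0 : ℝ), y (S.op t.toNNReal ψ) :=
    fun _ => rfl
  -- By the semigroup law, moving `φ` along the orbit cuts the integral down to its tail; the part
  -- lost is the integral over `(0, t]`.
  have hshift : ∫ s in Ioi (0 : ℝ), y (S.op s.toNNReal (S.op t.toNNReal φ)) =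
      ∫ s in Ioi t, y (S.op s.toNNReal φ) := by
    have h1 := (measurePreserving_add_right volume t).setIntegral_preimage_emb
      (measurableEmbedding_addRight t) (fun s : ℝ => y (S.op s.toNNReal φ)) (Ioi t)
    rw [← h1, preimage_add_const_Ioi, sub_self]
    refine setIntegral_congr_fun measurableSet_Ioi fun s hs => ?_
    simp only [S.op_toNNReal_add (le_of_lt hs) ht]
  rw [hx₀, hx₀, hshift]
  have h2 := intervalIntegral.integral_Ioi_sub_Ioi (hint φ) ht
  simp only [_root_.neg_apply, intervalIntegral.integral_neg]
  linarith

/-- The boundary term in `integral_eq` vanishes as `t → ∞`. Both positivity of minus the inverse and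
injectivity are read off this formula. -/
theorem IsExpStable.apply_integral (hS : S.IsExpStable) (hA : S.IsGenerator A)
    {x : StrongDual ℝ E} (hx : x ∈ A.domain) (φ : E) :
    x φ = -∫ t in Ioi (0 : ℝ), A ⟨x, hx⟩ (S.op t.toNNReal φ) := by
  have h1 := intervalIntegral_tendsto_integral_Ioi 0 (hS.integrableOn (A ⟨x, hx⟩) φ) tendsto_id
  have h2 := (hS.tendsto_zero x φ).sub_const (x φ)
  have h3 : Tendsto (fun t : ℝ => ∫ s in 0..t, A ⟨x, hx⟩ (S.op s.toNNReal φ)) atTop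
      (𝓝 (0 - x φ)) := by
    refine h2.congr' ?_
    filter_upwards [eventually_ge_atTop 0] with t ht
    rw [hA.integral_eq hx φ ht]
  have := tendsto_nhds_unique h1 h3
  linarith

/-- Minus the inverse of the generator of an exponentially stable positive semigroup is
positive. -/
theorem IsExpStable.mem_of_neg_apply_mem {P : PointedCone ℝ (StrongDual ℝ E)}
    (hP : IsClosedProper P) (hS : S.IsExpStable) (hpos : S.IsPositive P) (hA : S.IsGenerator A)
    {x : StrongDual ℝ E} (hx : x ∈ A.domain) (hAx : -A ⟨x, hx⟩ ∈ P) : x ∈ P := by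
  refine hP.mem_of_forall_nonneg fun φ hφ => ?_
  rw [hS.apply_integral hA hx φ, ← integral_neg]
  exact integral_nonneg fun t => hpos.op_mem _ hφ _ hAx

theorem IsExpStable.eq_of_apply_eq (hS : S.IsExpStable) (hA : S.IsGenerator A)
    {x y : StrongDual ℝ E} (hx : x ∈ A.domain) (hy : y ∈ A.domain)
    (h : A ⟨x, hx⟩ = A ⟨y, hy⟩) : x = y := by
  ext φ
  rw [hS.apply_integral hA hx, hS.apply_integral hA hy, h]

end C0Semigroup


/-! ### Datko–Pazy and stability from detection -/

namespace C0Semigroup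

variable {E : Type*} [NormedAddCommGroup E] [NormedSpace ℝ E] {S : C0Semigroup E}

theorem norm_op_add_le (S : C0Semigroup E) (s t : ℝ≥0) : ‖S.op (s + t)‖ ≤ ‖S.op s‖ * ‖S.op t‖ := by
  rw [S.op_add]
  exact ContinuousLinearMap.opNorm_comp_le _ _

theorem norm_adj_le (S : C0Semigroup E) (t : ℝ≥0) : ‖S.adj t‖ ≤ ‖S.op t‖ := by
  refine ContinuousLinearMap.opNorm_le_bound _ (norm_nonneg _) fun x => ?_
  refine ContinuousLinearMap.opNorm_le_bound _ (by positivity) fun φ => ?_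
  rw [adj_apply]
  calc ‖x (S.op t φ)‖ ≤ ‖x‖ * (‖S.op t‖ * ‖φ‖) :=
        x.le_of_opNorm_le_of_le le_rfl ((S.op t).le_opNorm φ)
    _ = _ := by ring

theorem exists_norm_op_le_of_le [CompleteSpace E] (S : C0Semigroup E) (a : ℝ≥0) :
    ∃ C, ∀ s ≤ a, ‖S.op s‖ ≤ C := by
  obtain ⟨C, hC⟩ := banach_steinhaus (g := fun s : Iic a => S.op s) fun φ => by
    obtain ⟨C, hC⟩ := S.exists_norm_op_le_on_Icc φ a
    refine ⟨C, fun s => ?_⟩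
    have := hC (s : ℝ≥0) ⟨NNReal.coe_nonneg _, NNReal.coe_le_coe.2 s.2⟩
    rwa [Real.toNNReal_coe] at this
  exact ⟨C, fun s hs => hC ⟨s, hs⟩⟩

/-- For `s ∈ (t, t + a]`, factoring `S.op (a + t)` through time `s` gives `‖S.op (a + t) φ‖ ≤ C *
‖S.op s φ‖`; integrate over this window of length `a`. Windows of length one bound the orbits; with
a global bound, long windows give decay like `1 / a`. -/
theorem FiniteNormIntegral.mul_norm_le {φ : E} (hφ : S.FiniteNormIntegral φ) {a : ℝ≥0} {C : ℝ}
    (hC : ∀ s ≤ a, ‖S.op s‖ ≤ C) (t : ℝ≥0) :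
    a * ‖S.op (a + t) φ‖ ≤ C * ∫ s in Ioi (0 : ℝ), ‖S.op s.toNNReal φ‖ := by
  have hC0 : 0 ≤ C := (norm_nonneg _).trans (hC 0 zero_le)
  have hle : (t : ℝ) ≤ t + a := by simp
  have hsub : Ioc (t : ℝ) (t + a) ⊆ Ioi 0 := fun s hs => t.2.trans_lt hs.1
  have hint : IntegrableOn (fun s : ℝ => C * ‖S.op s.toNNReal φ‖) (Ioi 0) :=
    Integrable.const_mul hφ C
  calc (a : ℝ) * ‖S.op (a + t) φ‖
      = ∫ _ in Ioc (t : ℝ) (t + a), ‖S.op (a + t) φ‖ := by simp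
    _ ≤ ∫ s in Ioc (t : ℝ) (t + a), C * ‖S.op s.toNNReal φ‖ := by
        refine setIntegral_mono_on (by simp) (hint.mono_set hsub) measurableSet_Ioc
          fun s hs => ?_
        have hs0 : 0 ≤ s := t.2.trans hs.1.le
        obtain ⟨s, rfl⟩ : ∃ r : ℝ≥0, (r : ℝ) = s := ⟨⟨s, hs0⟩, rfl⟩
        have hs2 : s ≤ a + t := by
          rw [add_comm]; exact_mod_cast hs.2
        have hs1 : a + t - s ≤ a := by
          rw [tsub_le_iff_right]
          have : t ≤ s := by exact_mod_cast hs.1.le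
          gcongr
        rw [Real.toNNReal_coe]
        conv_lhs => rw [← tsub_add_cancel_of_le hs2, op_add_apply]
        exact (S.op _).le_of_opNorm_le (hC _ hs1) _
    _ ≤ ∫ s in Ioi (0 : ℝ), C * ‖S.op s.toNNReal φ‖ :=
        setIntegral_mono_set hint (Eventually.of_forall fun s => by positivity)
          hsub.eventuallyLE
    _ = _ := integral_const_mul _ _

/-- A semigroup whose norm is bounded and less than one at some time is exponentially stable. -/
theorem isExpStable_of_norm_le_half {M : ℝ} (hM : ∀ t, ‖S.op t‖ ≤ M) {a : ℝ≥0} (ha : 0 < a)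
    (hhalf : ‖S.op a‖ ≤ 1 / 2) : S.IsExpStable := by
  have hpow : ∀ (n : ℕ) (r : ℝ≥0), ‖S.op (n * a + r)‖ ≤ (1 / 2) ^ n * M := by
    intro n r
    induction n with
    | zero => simpa using hM r
    | succ n ih =>
      have h1 : ((n + 1 : ℕ) : ℝ≥0) * a + r = a + (n * a + r) := by push_cast; ring
      rw [h1, pow_succ']
      calc _ ≤ ‖S.op a‖ * ‖S.op (n * a + r)‖ := S.norm_op_add_le _ _
        _ ≤ (1 / 2) * ((1 / 2) ^ n * M) := by gcongr
        _ = _ := by ring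
  have hM0 : 0 ≤ M := (norm_nonneg _).trans (hM 0)
  have ha' : (0 : ℝ) < a := ha
  -- The norm halves every `a` units of time; the factor `2` pays for rounding `t / a` down to `n`.
  refine ⟨2 * M, Real.log 2 / a, div_pos (Real.log_pos one_lt_two) ha', fun t => ?_⟩
  set n := ⌊t / a⌋₊
  have hn : n * a ≤ t := by
    rw [← le_div_iff₀ ha]; exact Nat.floor_le zero_le
  have hn' : (t : ℝ) / a ≤ n + 1 := by
    have := (Nat.lt_floor_add_one (t / a)).le
    exact_mod_cast this
  have h1 := hpow n (t - n * a)
  rw [add_tsub_cancel_of_le hn] at h1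
  calc ‖S.adj t‖ ≤ (1 / 2) ^ n * M := (S.norm_adj_le t).trans h1
    _ = 2 * M * Real.exp (-(n + 1 : ℝ) * Real.log 2) := by
        have : Real.exp (-(n + 1 : ℝ) * Real.log 2) = (1 / 2) ^ (n + 1) := by
          rw [neg_mul, Real.exp_neg, mul_comm, Real.exp_mul, Real.exp_log two_pos, one_div,
            inv_pow]
          norm_cast
        rw [this, pow_succ]; ring
    _ ≤ 2 * M * Real.exp (-(Real.log 2 / a) * t) := by
        have hlog := Real.log_pos one_lt_two
        have : -(Real.log 2 / a) * (t : ℝ) = -(t / a * Real.log 2) := by ring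
        rw [this, neg_mul]
        gcongr

/-- The Datko–Pazy theorem for exponent one: a semigroup all of whose orbits are
integrable is exponentially stable. -/
theorem isExpStable_of_finiteNormIntegral [CompleteSpace E]
    (h : ∀ φ, S.FiniteNormIntegral φ) : S.IsExpStable := by
  obtain ⟨C, hC⟩ := S.exists_norm_op_le_of_le 1
  have hC0 : 0 ≤ C := (norm_nonneg _).trans (hC 0 zero_le)
  obtain ⟨M, hM⟩ := banach_steinhaus (g := S.op) fun φ => by
    refine ⟨C * ‖φ‖ + C * ∫ s in Ioi (0 : ℝ), ‖S.op s.toNNReal φ‖, fun t => ?_⟩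
    have hI : 0 ≤ C * ∫ s in Ioi (0 : ℝ), ‖S.op s.toNNReal φ‖ :=
      mul_nonneg hC0 (integral_nonneg fun _ => norm_nonneg _)
    rcases le_total t 1 with ht | ht
    · have := (S.op t).le_of_opNorm_le (hC t ht) φ
      linarith
    · have := (h φ).mul_norm_le hC (t - 1)
      rw [add_tsub_cancel_of_le ht, NNReal.coe_one, one_mul] at this
      have : 0 ≤ C * ‖φ‖ := by positivity
      linarith
  obtain ⟨K, hK⟩ := banach_steinhaus (g := fun t : ℝ≥0 => (t : ℝ) • S.op t) fun φ => by
    refine ⟨M * ∫ s in Ioi (0 : ℝ), ‖S.op s.toNNReal φ‖, fun t => ?_⟩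
    have := (h φ).mul_norm_le (a := t) (fun s _ => hM s) 0
    simpa [norm_smul] using this
  have hK0 : 0 ≤ K := (norm_nonneg _).trans (hK 0)
  -- Since `t * ‖S.op t‖ ≤ K`, any positive time of at least `2 * K` has norm at most one half.
  obtain ⟨a, ha⟩ : ∃ a : ℝ≥0, (a : ℝ) = 2 * K + 1 := ⟨⟨2 * K + 1, by positivity⟩, rfl⟩
  have ha0 : (0 : ℝ) < a := by rw [ha]; positivity
  refine isExpStable_of_norm_le_half hM (a := a) ha0 ?_
  have := hK a
  rw [norm_smul, Real.norm_of_nonneg ha0.le, ha] at this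
  by_contra! hlt
  nlinarith

variable {A : StrongDual ℝ E →ₗ.[ℝ] StrongDual ℝ E}

/-- If `A y ≤ -z` with `y, z ≥ 0`, then the orbits of positive functionals have finite pairing
integrals with `z`. -/
theorem IsGenerator.finitePairingIntegral {P : PointedCone ℝ (StrongDual ℝ E)}
    (hpos : S.IsPositive P) (hA : S.IsGenerator A) {y z : StrongDual ℝ E} (hyP : y ∈ P)
    (hz : z ∈ P) (hy : y ∈ A.domain) (h : -(A ⟨y, hy⟩ + z) ∈ P) {φ : E}
    (hφ : φ ∈ predualCone P) : S.FinitePairingIntegral z φ := by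
  have hcont : ∀ w : StrongDual ℝ E, Continuous fun t : ℝ => w (S.op t.toNNReal φ) :=
    fun w => w.continuous.comp (S.continuous_op_toNNReal φ)
  refine integrableOn_Ioi_of_intervalIntegral_norm_bounded (l := atTop) (b := id) (y φ) 0
    (fun t => ((hcont z).integrableOn_Icc).mono_set Ioc_subset_Icc_self) tendsto_id ?_
  filter_upwards [eventually_ge_atTop 0] with t ht
  -- The orbit `y (S.op s φ)` stays nonnegative and falls at rate at least `z (S.op s φ)`, so the
  -- total cannot exceed `y φ`.
  calc ∫ s in 0..t, ‖z (S.op s.toNNReal φ)‖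
      ≤ ∫ s in 0..t, -A ⟨y, hy⟩ (S.op s.toNNReal φ) := by
        refine intervalIntegral.integral_mono_on ht ((hcont z).norm.intervalIntegrable _ _)
          ((hcont (A ⟨y, hy⟩)).neg.intervalIntegrable _ _) fun s _ => ?_
        have hmem := hpos.op_mem s.toNNReal hφ
        rw [Real.norm_of_nonneg (hmem z hz)]
        have := hmem _ h
        simp only [_root_.neg_apply, _root_.add_apply] at this
        linarith
    _ = y φ - y (S.op t.toNNReal φ) := by
        rw [intervalIntegral.integral_neg, hA.integral_eq hy φ ht]; ring
    _ ≤ y φ := sub_le_self _ (hpos.op_mem _ hφ y hyP)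

/-- Finiteness spreads from the pairing to the norm on `F` by detection, from `F` to the predual
cone by the stability property, and to all of `E` by taking differences; then Datko–Pazy applies. -/
theorem isExpStable_of_finitePairingIntegral [CompleteSpace E]
    {P : PointedCone ℝ (StrongDual ℝ E)} (hgen : IsGenerating (predualCone P))
    {𝒞 : Set (C0Semigroup E)} {F : Set E} (hF : IsStabilitySubset P 𝒞 F) (hS : S ∈ 𝒞)
    {z : StrongDual ℝ E} (hz : S.IsL1Detector P F z)
    (h : ∀ φ ∈ F, S.FinitePairingIntegral z φ) : S.IsExpStable := by
  have hcone := hF.2 S hS fun φ hφ => hz.2 φ hφ (h φ hφ)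
  refine isExpStable_of_finiteNormIntegral fun φ => ?_
  obtain ⟨a, ha, b, hb, rfl⟩ := hgen φ
  refine Integrable.mono' (Integrable.add (hcone a ha) (hcone b hb))
    (S.continuous_op_toNNReal _).norm.aestronglyMeasurable (Eventually.of_forall fun t => ?_)
  rw [norm_norm, map_sub]
  exact norm_sub_le _ _

end C0Semigroup

/-! ### Supersolutions and Newton's iteration -/

section Newton

variable {E : Type*} [NormedAddCommGroup E] [NormedSpace ℝ E]
  {P : PointedCone ℝ (StrongDual ℝ E)}
  {A : StrongDual ℝ E →ₗ.[ℝ] StrongDual ℝ E} {Φ : StrongDual ℝ E → StrongDual ℝ E}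
  {Φ' : StrongDual ℝ E → StrongDual ℝ E →L[ℝ] StrongDual ℝ E}

/-- An order concave function lies below its tangents. -/
theorem IsOrderConcave.le_tangent (hP : IsClosedProper P) (hconc : IsOrderConcave P Φ)
    (hderiv : IsGateauxDeriv P Φ Φ') {x y : StrongDual ℝ E} (hx : x ∈ P) (hy : y ∈ P) :
    ConeLE P (Φ y) (Φ x + Φ' x (y - x)) := by
  have hcomb : ∀ t : ℝ, x + t • (y - x) = t • y + (1 - t) • x := fun t => by module
  have hmem : ∀ t ∈ Ioc (0 : ℝ) 1, x + t • (y - x) ∈ P := fun t ht => by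
    rw [hcomb]
    exact P.convex hy hx ht.1.le (sub_nonneg.2 ht.2) (by ring)
  refine hP.mem_of_forall_nonneg fun φ hφ => ?_
  have hd : HasDerivWithinAt (fun t : ℝ => Φ (x + t • (y - x))) (Φ' x (y - x)) (Ioc 0 1) 0 :=
    HasDerivWithinAt.mono (hderiv x hx (y - x)) hmem
  have hd' := (ContinuousLinearMap.apply ℝ ℝ φ).hasFDerivAt.comp_hasDerivWithinAt 0 hd
  rw [hasDerivWithinAt_iff_tendsto_slope' (by simp), nhdsWithin_Ioc_eq_nhdsGT one_pos] at hd'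
  -- Concavity makes every slope along the segment from `x` to `y` at least the full increment; let
  -- the step tend to zero.
  have hge : Φ y φ - Φ x φ ≤ Φ' x (y - x) φ := by
    refine ge_of_tendsto hd' ?_
    filter_upwards [Ioc_mem_nhdsGT one_pos] with t ht
    have h := hφ _ (hconc t ⟨ht.1.le, ht.2⟩ y hy x hx)
    rw [← hcomb] at h
    simp only [_root_.sub_apply, _root_.add_apply, _root_.smul_apply, smul_eq_mul] at h
    rw [slope_def_field, le_div_iff₀ (by simpa using ht.1)]
    simp only [Function.comp_apply, ContinuousLinearMap.apply_apply, sub_zero, zero_smul, add_zero]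
    linarith
  simp only [_root_.sub_apply, _root_.add_apply]
  linarith

/-- `y ∈ P ∩ D(A)` satisfies `A y + Φ y ≤ 0`. -/
def IsSupersolution (P : PointedCone ℝ (StrongDual ℝ E))
    (A : StrongDual ℝ E →ₗ.[ℝ] StrongDual ℝ E) (Φ : StrongDual ℝ E → StrongDual ℝ E)
    (y : StrongDual ℝ E) : Prop :=
  y ∈ P ∧ ∃ hy : y ∈ A.domain, -(A ⟨y, hy⟩ + Φ y) ∈ P

theorem IsSolution.isSupersolution {y : StrongDual ℝ E} (hy : y ∈ P) (h : IsSolution A Φ y) :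
    IsSupersolution P A Φ y := by
  obtain ⟨hd, h⟩ := h
  exact ⟨hy, hd, by rw [h, neg_zero]; exact P.zero_mem⟩

theorem linearization_apply {x y : StrongDual ℝ E} (hy : y ∈ A.domain) :
    linearization A Φ' x ⟨y, hy⟩ = Φ' x y + A ⟨y, hy⟩ := rfl

theorem isNewtonStep_iff_apply {u v : StrongDual ℝ E} :
    IsNewtonStep A Φ Φ' u v ↔
      ∃ hv : v ∈ A.domain, Φ' u v + A ⟨v, hv⟩ = -(Φ u - Φ' u u) :=
  Iff.rfl

/-- Under global `L¹` detectability supersolutions are stabilizing. -/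
theorem IsSupersolution.stabilizes [CompleteSpace E] (hgen : IsGenerating (predualCone P))
    (hdet : GloballyL1Detectable P A Φ Φ') {y : StrongDual ℝ E}
    (h : IsSupersolution P A Φ y) : Stabilizes P A Φ' y := by
  obtain ⟨F, hF, hdet⟩ := hdet
  obtain ⟨hyP, hy, h⟩ := h
  obtain ⟨S, hpos, hS, hL⟩ := hdet y hyP
  refine ⟨hyP, S, hpos, hS, ?_⟩
  refine C0Semigroup.isExpStable_of_finitePairingIntegral hgen hF ⟨y, hyP, hS⟩ hL fun φ hφ => ?_
  refine hS.finitePairingIntegral hpos hyP hL.1 hy ?_ (hF.1 hφ)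
  -- In `F'(y) y + L(y)` the terms `Φ' y y` cancel, leaving `A y + Φ y`.
  rw [linearization_apply]
  convert h using 1
  abel

theorem GloballyL1Detectable.sub_mem (hdet : GloballyL1Detectable P A Φ Φ')
    {x : StrongDual ℝ E} (hx : x ∈ P) : Φ x - Φ' x x ∈ P := by
  obtain ⟨F, -, hdet⟩ := hdet
  obtain ⟨S, -, -, hL⟩ := hdet x hx
  exact hL.1

theorem Stabilizes.exists_isNewtonStep {x : StrongDual ℝ E} (hx : Stabilizes P A Φ' x) :
    ∃ v, IsNewtonStep A Φ Φ' x v := by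
  obtain ⟨-, S, -, hS, hexp⟩ := hx
  obtain ⟨v, hv, -⟩ := hexp.exists_apply_eq_neg hS (Φ x - Φ' x x)
  exact ⟨v, hv⟩

theorem Stabilizes.isNewtonStep_unique {x v w : StrongDual ℝ E} (hx : Stabilizes P A Φ' x)
    (hv : IsNewtonStep A Φ Φ' x v) (hw : IsNewtonStep A Φ Φ' x w) : v = w := by
  obtain ⟨-, S, -, hS, hexp⟩ := hx
  obtain ⟨hv, hv'⟩ := hv
  obtain ⟨hw, hw'⟩ := hw
  exact hexp.eq_of_apply_eq hS hv hw (hv'.trans hw'.symm)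

/-- A Newton step from a stabilizing element leads to a supersolution. -/
theorem IsNewtonStep.isSupersolution (hP : IsClosedProper P) (hconc : IsOrderConcave P Φ)
    (hderiv : IsGateauxDeriv P Φ Φ') {x v : StrongDual ℝ E} (hL : Φ x - Φ' x x ∈ P)
    (hx : Stabilizes P A Φ' x) (hv : IsNewtonStep A Φ Φ' x v) : IsSupersolution P A Φ v := by
  obtain ⟨hxP, S, hpos, hS, hexp⟩ := hx
  obtain ⟨hd, hv⟩ := isNewtonStep_iff_apply.1 hv
  have hvP : v ∈ P := by
    refine hexp.mem_of_neg_apply_mem hP hpos hS hd ?_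
    rwa [linearization_apply, hv, neg_neg]
  refine ⟨hvP, hd, ?_⟩
  -- By the Newton equation, `A v + Φ v` is `Φ v` minus the tangent of `Φ` at `x` evaluated at `v`.
  have h := hconc.le_tangent hP hderiv hxP hvP
  have hAv : A ⟨v, hd⟩ = -(Φ x - Φ' x x) - Φ' x v := by
    rw [← hv]; abel
  rw [hAv]
  unfold ConeLE at h
  convert h using 1
  rw [map_sub]
  abel

/-- `F'(x)` is inverse negative at a stabilizing `x`. -/
theorem Stabilizes.coneLE (hP : IsClosedProper P) {x v w : StrongDual ℝ E}
    (hx : Stabilizes P A Φ' x) (hv : v ∈ A.domain) (hw : w ∈ A.domain)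
    (h : ConeLE P (Φ' x w + A ⟨w, hw⟩) (Φ' x v + A ⟨v, hv⟩)) : ConeLE P v w := by
  obtain ⟨-, S, hpos, hS, hexp⟩ := hx
  refine hexp.mem_of_neg_apply_mem hP hpos hS (A.domain.sub_mem hw hv) ?_
  have : A ⟨w - v, A.domain.sub_mem hw hv⟩ = A ⟨w, hw⟩ - A ⟨v, hv⟩ := by
    rw [← LinearPMap.map_sub]; rfl
  rw [linearization_apply, this, map_sub]
  unfold ConeLE at h
  convert h using 1
  abel

/-- A Newton step from a stabilizing supersolution decreases. -/
theorem IsNewtonStep.coneLE (hP : IsClosedProper P) {x v : StrongDual ℝ E}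
    (hx : Stabilizes P A Φ' x) (hsup : IsSupersolution P A Φ x)
    (hv : IsNewtonStep A Φ Φ' x v) : ConeLE P v x := by
  obtain ⟨-, hd, h⟩ := hsup
  obtain ⟨hvd, hv⟩ := isNewtonStep_iff_apply.1 hv
  -- `F'(x) x = (A x + Φ x) - L(x) ≤ -L(x) = F'(x) v`.
  refine hx.coneLE hP hvd hd ?_
  unfold ConeLE
  rw [hv]
  convert h using 1
  abel

/-- The tangent inequality gives `0 = F(y) ≤ F(x) + F'(x)(y - x) = F'(x)(y - x)`, and `F'(x)` is
inverse negative. Stabilizing solutions are therefore maximal. -/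
theorem IsSolution.coneLE (hP : IsClosedProper P) (hconc : IsOrderConcave P Φ)
    (hderiv : IsGateauxDeriv P Φ Φ') {x y : StrongDual ℝ E} (hx : Stabilizes P A Φ' x)
    (hsx : IsSolution A Φ x) (hyP : y ∈ P) (hsy : IsSolution A Φ y) : ConeLE P y x := by
  have h := hconc.le_tangent hP hderiv hx.1 hyP
  obtain ⟨hxd, hsx⟩ := hsx
  obtain ⟨hyd, hsy⟩ := hsy
  refine hx.coneLE hP hyd hxd ?_
  rw [eq_neg_of_add_eq_zero_left hsx, eq_neg_of_add_eq_zero_left hsy]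
  unfold ConeLE at h ⊢
  convert h using 1
  rw [map_sub]
  abel

theorem isDecreasing_of_succ {u : ℕ → StrongDual ℝ E}
    (h : ∀ n, ConeLE P (u (n + 1)) (u n)) : IsDecreasing P u := by
  intro m n hmn
  induction n, hmn using Nat.le_induction with
  | base => unfold ConeLE; rw [sub_self]; exact P.zero_mem
  | succ n _ ih =>
    have := P.add_mem ih (h n)
    rwa [sub_add_sub_cancel] at this

theorem IsDecreasing.isOrderBounded {u : ℕ → StrongDual ℝ E} (hu : IsDecreasing P u)
    (huP : ∀ n, u n ∈ P) : IsOrderBounded P u :=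
  ⟨0, u 0, fun n => ⟨by simpa [ConeLE] using huP n, hu 0 n (Nat.zero_le n)⟩⟩

/-- The weak* limit of a decreasing sequence of Newton iterates is a solution. -/
theorem isSolution_of_tendstoWeakStar [CompleteSpace E] {S : C0Semigroup E} (hS : S.IsGenerator A)
    (hcont : ContinuousOnMonotoneSeq P Φ)
    (hcont' : ContinuousOnMonotoneSeq₂ P (fun x y => Φ' x y)) {u : ℕ → StrongDual ℝ E}
    (huP : ∀ n, u n ∈ P) (hu : IsDecreasing P u)
    (hstep : ∀ n, IsNewtonStep A Φ Φ' (u n) (u (n + 1))) {x : StrongDual ℝ E} (hx : x ∈ P)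
    (hlim : TendstoWeakStar u atTop x) : IsSolution A Φ x := by
  have hu' : IsDecreasing P fun n => u (n + 1) :=
    fun m n hmn => hu _ _ (Nat.succ_le_succ hmn)
  have hlim' : TendstoWeakStar (fun n => u (n + 1)) atTop x :=
    (tendsto_add_atTop_iff_nat 1).2 hlim
  have hb := hu.isOrderBounded huP
  have hb' := hu'.isOrderBounded fun n => huP (n + 1)
  have h1 := hcont u x huP hx hb (Or.inr hu) hlim
  have h2 := hcont' u u x x huP huP hx hx hb hb (Or.inr ⟨hu, hu⟩) hlim hlim
  have h3 := hcont' u (fun n => u (n + 1)) x x huP (fun n => huP (n + 1)) hx hx hb hb'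
    (Or.inr ⟨hu, hu'⟩) hlim hlim'
  -- `A u_{n+1} = -(Φ u_n - Φ' u_n u_n) - Φ' u_n u_{n+1}`; in the limit the two `Φ'` terms cancel.
  have hA := hS.of_tendstoWeakStar (u := fun n => u (n + 1)) (fun n => ?_) hlim'
    ((h1.sub h2).neg.sub h3)
  · obtain ⟨hd, hA⟩ := hA
    exact ⟨hd, by rw [hA]; abel⟩
  · obtain ⟨hd, h⟩ := isNewtonStep_iff_apply.1 (hstep n)
    exact ⟨hd, by rw [← h]; abel⟩

/-- Newton's iteration from a stabilizing starting point decreases to a solution. -/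
theorem exists_newton_sequence [CompleteSpace E] (hP : IsClosedProper P)
    (hgen : IsGenerating (predualCone P)) {S : C0Semigroup E} (hS : S.IsGenerator A)
    (hconc : IsOrderConcave P Φ) (hderiv : IsGateauxDeriv P Φ Φ')
    (hcont : ContinuousOnMonotoneSeq P Φ)
    (hcont' : ContinuousOnMonotoneSeq₂ P (fun x y => Φ' x y))
    (hdet : GloballyL1Detectable P A Φ Φ') {x₀ : StrongDual ℝ E}
    (hx₀ : Stabilizes P A Φ' x₀) :
    ∃ x : ℕ → StrongDual ℝ E, x 0 = x₀ ∧ (∀ n, Stabilizes P A Φ' (x n)) ∧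
      (∀ n, IsNewtonStep A Φ Φ' (x n) (x (n + 1))) ∧
      (∀ n, 1 ≤ n → x n ∈ A.domain) ∧
      (∀ m n, 1 ≤ m → m ≤ n → ConeLE P (x n) (x m)) ∧
      ∃ xinf ∈ P, IsSolution A Φ xinf ∧ TendstoWeakStar x atTop xinf := by
  have hnext : ∀ u : {u // Stabilizes P A Φ' u}, ∃ v : {v // Stabilizes P A Φ' v},
      IsNewtonStep A Φ Φ' u v := by
    intro ⟨u, hu⟩
    obtain ⟨v, hv⟩ := hu.exists_isNewtonStep (Φ := Φ)
    exact ⟨⟨v, (hv.isSupersolution hP hconc hderiv (hdet.sub_mem hu.1) hu).stabilizes hgen hdet⟩,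
      hv⟩
  choose next hnext using hnext
  let x : ℕ → {u // Stabilizes P A Φ' u} := fun n => next^[n] ⟨x₀, hx₀⟩
  have hstep : ∀ n, IsNewtonStep A Φ Φ' (x n) (x (n + 1)) := fun n => by
    simp only [x, Function.iterate_succ_apply']
    exact hnext _
  -- The starting point need not be a supersolution, so monotonicity begins at index one.
  have hsup : ∀ n, IsSupersolution P A Φ (x (n + 1)) := fun n =>
    (hstep n).isSupersolution hP hconc hderiv (hdet.sub_mem (x n).2.1) (x n).2
  have hdec : IsDecreasing P fun n => (x (n + 1) : StrongDual ℝ E) :=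
    isDecreasing_of_succ fun n => (hstep (n + 1)).coneLE hP (x (n + 1)).2 (hsup n)
  obtain ⟨xinf, hxinf, hlim⟩ := hdec.exists_tendstoWeakStar hP hgen fun n => (hsup n).1
  refine ⟨fun n => x n, rfl, fun n => (x n).2, hstep, fun n hn => ?_, fun m n hm hmn => ?_,
    xinf, hxinf, isSolution_of_tendstoWeakStar hS hcont hcont' (fun n => (hsup n).1) hdec
      (fun n => hstep (n + 1)) hxinf hlim, ?_⟩
  · obtain ⟨k, rfl⟩ := Nat.exists_eq_add_of_le' hn
    exact (hsup k).2.1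
  · obtain ⟨k, rfl⟩ := Nat.exists_eq_add_of_le' hm
    obtain ⟨l, rfl⟩ := Nat.exists_eq_add_of_le' (hm.trans hmn)
    exact hdec k l (Nat.le_of_succ_le_succ hmn)
  · exact (tendsto_add_atTop_iff_nat 1).1 hlim

end Newton

end ConcaveNewton

theorem theorem5 {E : Type*} [NormedAddCommGroup E] [NormedSpace ℝ E] [CompleteSpace E]
    (P : PointedCone ℝ (StrongDual ℝ E)) (hP : IsClosedProper P)
    (hgen : IsGenerating (predualCone P))
    (A : StrongDual ℝ E →ₗ.[ℝ] StrongDual ℝ E)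
    (hA : ∃ S : C0Semigroup E, S.IsPositive P ∧ S.IsGenerator A)
    (Φ : StrongDual ℝ E → StrongDual ℝ E)
    (Φ' : StrongDual ℝ E → StrongDual ℝ E →L[ℝ] StrongDual ℝ E)
    (hconc : IsOrderConcave P Φ)
    (hderiv : IsGateauxDeriv P Φ Φ')
    (hzero : ConeLE P 0 (Φ 0))
    (hcont : ContinuousOnMonotoneSeq P Φ)
    (hcont' : ContinuousOnMonotoneSeq₂ P (fun x y => Φ' x y))
    (hstab : ∃ x, Stabilizes P A Φ' x)
    (hdet : GloballyL1Detectable P A Φ Φ') :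
    ∃ xinf ∈ P, IsSolution A Φ xinf ∧
      (∀ y ∈ P, IsSolution A Φ y → y = xinf) ∧
      Stabilizes P A Φ' xinf ∧
      ∀ x₀, Stabilizes P A Φ' x₀ →
        ∃ x : ℕ → StrongDual ℝ E, x 0 = x₀ ∧
          (∀ n, IsNewtonStep A Φ Φ' (x n) (x (n + 1)) ∧
            ∀ v, IsNewtonStep A Φ Φ' (x n) v → v = x (n + 1)) ∧
          (∀ n, x n ∈ P) ∧
          (∀ n, 1 ≤ n → x n ∈ A.domain) ∧
          (∀ m n, 1 ≤ m → m ≤ n → ConeLE P (x n) (x m)) ∧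
          TendstoWeakStar x atTop xinf := by
  obtain ⟨S, -, hS⟩ := hA
  have hseq := fun {x₀ : StrongDual ℝ E} (hx₀ : Stabilizes P A Φ' x₀) =>
    exists_newton_sequence hP hgen hS hconc hderiv hcont hcont' hdet hx₀
  have hstable : ∀ y ∈ P, IsSolution A Φ y → Stabilizes P A Φ' y := fun y hyP hy =>
    (hy.isSupersolution hyP).stabilizes hgen hdet
  have huniq : ∀ y ∈ P, ∀ z ∈ P, IsSolution A Φ y → IsSolution A Φ z → y = z := by
    intro y hyP z hzP hy hz
    have h1 : ConeLE P y z := hz.coneLE hP hconc hderiv (hstable z hzP hz) hyP hy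
    have h2 : ConeLE P z y := hy.coneLE hP hconc hderiv (hstable y hyP hy) hzP hz
    unfold ConeLE at h1 h2
    rw [← neg_sub] at h1
    exact sub_eq_zero.1 (hP.proper _ h2 h1)
  obtain ⟨x₁, hx₁⟩ := hstab
  obtain ⟨-, -, -, -, -, -, xinf, hxinf, hsol, -⟩ := hseq hx₁
  refine ⟨xinf, hxinf, hsol, fun y hyP hy => huniq y hyP xinf hxinf hy hsol,
    hstable xinf hxinf hsol, fun x₀ hx₀ => ?_⟩
  obtain ⟨x, h0, hst, hstep, hdom, hdec, y, hyP, hy, hlim⟩ := hseq hx₀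
  -- Uniqueness identifies the limits of iterations from different starting points.
  obtain rfl := huniq y hyP xinf hxinf hy hsol
  exact ⟨x, h0, fun n => ⟨hstep n, fun v hv => (hst n).isNewtonStep_unique hv (hstep n)⟩,
    fun n => (hst n).1, hdom, hdec, hlim⟩
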